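/- Let $U\subseteq\mathbb{R}^d$ be open and convex, and let $f:U\to\mathbb{R}$ be a convex function of the form $f=\ell+c$, where $\ell:\mathbb{R}^d\to\mathbb{R}$ is linear and $c:U\to\mathbb{R}$ is proper, meaning that there are $-\infty<a<B\le\infty$ such that $c(U)\subseteq[a,B)$ and $c^{-1}[a,\beta]$ is compact for every $\beta\in[a,B)$. Let $b\in\mathbb{R}$ with $b>\min_U c$, suppose that $K=c^{-1}(-\infty,b]$ is a compact convex body (with nonempty interior), and let $\varepsilon:\operatorname{int}(K)\to(0,\infty)$ be continuous. Then there exists a convex function $F:U\to\mathbb{R}$ such that 1. $F=f$ on $U\setminus\operatorname{int}(K)$; 2. $|F-f|\le\varepsilon$ on $\operatorname{int}(K)$; 3. $F$ is strongly convex and real analytic on $\operatorname{int}(K)$; 4. $\partial F(x)=\partial f(x)$ for each $x\in\partial K$; and moreover, if $f$ is $C^1$ at the points of $U\setminus\operatorname{int}(K)$, i.e. $f:U\to\mathbb{R}$ is differentiable at every point of $U\setminus\operatorname{int}(K)$ and its derivative is continuous on $U\setminus\operatorname{int}(K)$, then $F\in C^1(U)$. Here $\partial g(x)=\{\zeta:\mathbb{R}^d\to\mathbb{R}\text{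 linear}: g(y)-g(x)\ge\zeta(y-x)\text{ for all }y\in U\}$ for $g:U\to\mathbb{R}$ and $x\in U$. A $C^2$ function $\varphi$ on an open set $W$ is strongly convex if $D^2\varphi(x)(v,v)>0$ for all $x\in W$ and $v\ne0$; a function $g$ on an open set $V$ is strongly convex if every point of $V$ has an open convex neighbourhood $W\subseteq V$ with a strongly convex $\varphi\in C^2(W)$ such that $g-\varphi$ is convex on $W$. -/

import Mathlib

/-- `c : U → ℝ` is proper: for some real `a` and some `B` with `a < B ≤ ∞`, it takes values in
`[a, B)` on `U`, and `{x ∈ U | a ≤ c x ≤ β}` is compact for every real `β ∈ [a, B)`.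
Values of `c` outside `U` are irrelevant. -/
def IsProperOn {d : ℕ} (U : Set (EuclideanSpace ℝ (Fin d)))
    (c : EuclideanSpace ℝ (Fin d) → ℝ) : Prop :=
  ∃ (a : ℝ) (B : EReal), (a : EReal) < B ∧
    (∀ x ∈ U, a ≤ c x ∧ (c x : EReal) < B) ∧
    ∀ β : ℝ, a ≤ β → (β : EReal) < B → IsCompact {x ∈ U | a ≤ c x ∧ c x ≤ β}

/-- A `C²` function on the open set `W` whose second derivative along every nonconstant line is
strictly positive at every point of `W`. -/
def IsC2StronglyConvexOn {d : ℕ} (W : Set (EuclideanSpace ℝ (Fin d)))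
    (φ : EuclideanSpace ℝ (Fin d) → ℝ) : Prop :=
  ContDiffOn ℝ 2 φ W ∧
    ∀ x ∈ W, ∀ v : EuclideanSpace ℝ (Fin d), v ≠ 0 → 0 < fderiv ℝ (fderiv ℝ φ) x v v

/-- Strong convexity of a not necessarily smooth function on the open set `V`: near every point of
`V` it is the sum of a convex function and a `C²` strongly convex function.
(`ConvexOn` includes that the neighbourhood `W` is convex; this is no restriction, since
neighbourhoods can be shrunk to balls.) -/
def IsStronglyConvexOn {d : ℕ} (V : Set (EuclideanSpace ℝ (Fin d)))
    (g : EuclideanSpace ℝ (Fin d) → ℝ) : Prop :=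
  ∀ p ∈ V, ∃ W : Set (EuclideanSpace ℝ (Fin d)), IsOpen W ∧ p ∈ W ∧ W ⊆ V ∧
    ∃ φ : EuclideanSpace ℝ (Fin d) → ℝ,
      IsC2StronglyConvexOn W φ ∧ ConvexOn ℝ W (fun x => g x - φ x)

/-- The subdifferential at `x` of a function `g : U → ℝ`: the linear functionals `ζ` with
`g y - g x ≥ ζ (y - x)` for all `y ∈ U`. -/
def subdifferentialOn {d : ℕ} (U : Set (EuclideanSpace ℝ (Fin d)))
    (g : EuclideanSpace ℝ (Fin d) → ℝ) (x : EuclideanSpace ℝ (Fin d)) :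
    Set (EuclideanSpace ℝ (Fin d) →L[ℝ] ℝ) :=
  {ζ | ∀ y ∈ U, ζ (y - x) ≤ g y - g x}

/-- `g` is of class `C¹` at the points of `A` (a not necessarily open set): it is differentiable,
as a function on a full neighbourhood, at every point of `A`, and its derivative is continuous
on `A`. -/
def IsC1AtPointsOf {d : ℕ} (A : Set (EuclideanSpace ℝ (Fin d)))
    (g : EuclideanSpace ℝ (Fin d) → ℝ) : Prop :=
  (∀ x ∈ A, DifferentiableAt ℝ g x) ∧ ContinuousOn (fderiv ℝ g) A

open Set Filter Topology Metric

theorem analyticAt_tsum_exp {ι V : Type*} [NormedAddCommGroup V] [NormedSpace ℝ V]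
    (l : ι → V →L[ℝ] ℝ) (a : ι → ℝ) (p : V) {r : ℝ} (hr : 0 < r) {u : ι → ℝ} (hu : Summable u)
    (h : ∀ k, ∀ v ∈ closedBall p r, Real.exp (l k v + a k) ≤ u k) :
    AnalyticAt ℝ (fun v => ∑' k, Real.exp (l k v + a k)) p := by
  have hup : ∀ k, 0 < u k := fun k =>
    (Real.exp_pos _).trans_le (h k p (mem_closedBall_self hr.le))
  have hbd : ∀ k, Real.exp (l k p + a k) * Real.exp (‖l k‖ * r) ≤ u k := by
    intro k
    have h1 : ∀ v ∈ closedBall (0 : V) r, l k v ≤ Real.log (u k) - (l k p + a k) := by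
      intro v hv
      have := h k (p + v) (by simpa using hv)
      rw [← Real.le_log_iff_exp_le (hup k), map_add] at this
      linarith
    have h2 : ∀ v ∈ closedBall (0 : V) r, ‖l k v‖ ≤ Real.log (u k) - (l k p + a k) := by
      intro v hv
      rw [Real.norm_eq_abs, abs_le']
      refine ⟨h1 v hv, ?_⟩
      have := h1 (-v) (by simpa using hv)
      rwa [map_neg] at this
    have h3 := ContinuousLinearMap.opNorm_bound_of_ball_bound hr _ (l k) h2
    rw [le_div_iff₀ hr] at h3
    rw [← Real.exp_add, ← Real.le_log_iff_exp_le (hup k)]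
    linarith
  set e : ι → ℝ := fun k => Real.exp (l k p + a k) with he
  have hepos : ∀ k, 0 < e k := fun k => Real.exp_pos _
  let q : ι → FormalMultilinearSeries ℝ V ℝ := fun k =>
    (NormedSpace.expSeries ℝ ℝ).compContinuousLinearMap (l k)
  have hqn : ∀ k n, ‖q k n‖ ≤ ‖l k‖ ^ n / n.factorial := by
    intro k n
    refine ((NormedSpace.expSeries ℝ ℝ n).norm_compContinuousLinearMap_le _).trans ?_
    simp only [Finset.prod_const, Finset.card_univ, Fintype.card_fin]
    rw [div_eq_inv_mul]
    gcongr
    have := NormedSpace.expSeries_eq_ofScalars ℝ ℝ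
    rw [this]
    refine (FormalMultilinearSeries.ofScalars_norm_eq_mul _ _ _).le.trans ?_
    simp
  have hqv : ∀ k n y, (q k n fun _ => y) = (l k y) ^ n / n.factorial := by
    intro k n y
    simp only [q, FormalMultilinearSeries.compContinuousLinearMap_apply]
    have := NormedSpace.expSeries_apply_eq (𝕂 := ℝ) (l k y) n
    simp only [smul_eq_mul] at this
    rw [div_eq_inv_mul, ← this]
    rfl
  have hexp : ∀ t : ℝ, HasSum (fun n : ℕ => t ^ n / n.factorial) (Real.exp t) := by
    intro t
    have := NormedSpace.exp_series_hasSum_exp' (𝕂 := ℝ) t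
    rw [← Real.exp_eq_exp_ℝ] at this
    simpa [div_eq_inv_mul] using this
  have hsum : Summable fun z : ι × ℕ => e z.1 * ((‖l z.1‖ * r) ^ z.2 / z.2.factorial) := by
    rw [summable_prod_of_nonneg]
    · refine ⟨fun k => ((hexp (‖l k‖ * r)).summable).mul_left (e k), ?_⟩
      refine Summable.of_nonneg_of_le (fun k => tsum_nonneg fun n => ?_) (fun k => ?_) hu
      · have := hepos k
        positivity
      · simp only
        rw [tsum_mul_left, (hexp (‖l k‖ * r)).tsum_eq]
        exact hbd k
    · intro z
      have := hepos z.1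
      simp only [Pi.zero_apply]
      positivity
  have hterm : ∀ n k, ‖e k • q k n‖ * r ^ n ≤ e k * ((‖l k‖ * r) ^ n / n.factorial) := by
    intro n k
    rw [norm_smul, Real.norm_eq_abs, abs_of_pos (hepos k), mul_assoc]
    refine mul_le_mul_of_nonneg_left ?_ (hepos k).le
    rw [mul_pow, mul_div_right_comm]
    exact mul_le_mul_of_nonneg_right (hqn k n) (by positivity)
  have hsum' : Summable fun z : ℕ × ι => e z.2 * ((‖l z.2‖ * r) ^ z.1 / z.1.factorial) :=
    hsum.prod_symm
  have hqs : ∀ n, Summable fun k => ‖e k • q k n‖ := by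
    intro n
    have h1 := hsum'.prod_factor n
    have h2 : Summable fun k => ‖e k • q k n‖ * r ^ n :=
      Summable.of_nonneg_of_le (fun k => by positivity) (hterm n) h1
    have := h2.mul_right ((r ^ n)⁻¹)
    refine this.congr fun k => ?_
    field_simp
  let P : FormalMultilinearSeries ℝ V ℝ := fun n => ∑' k, e k • q k n
  refine ⟨P, ENNReal.ofReal r, ?_, by simpa using hr, ?_⟩
  · change (r.toNNReal : ENNReal) ≤ _
    refine P.le_radius_of_summable_norm ?_
    refine Summable.of_nonneg_of_le (fun n => by positivity) (fun n => ?_) hsum'.prod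
    rw [Real.coe_toNNReal r hr.le]
    calc ‖P n‖ * r ^ n ≤ (∑' k, ‖e k • q k n‖) * r ^ n := by
          gcongr
          exact norm_tsum_le_tsum_norm (hqs n)
      _ = ∑' k, ‖e k • q k n‖ * r ^ n := by rw [tsum_mul_right]
      _ ≤ _ := ((hqs n).mul_right _).tsum_le_tsum (hterm n) (hsum'.prod_factor n)
  · intro y hy
    have hyr : ‖y‖ < r := by
      simpa [Metric.mem_eball, edist_zero_right, ← ofReal_norm,
        ENNReal.ofReal_lt_ofReal_iff hr] using hy
    have hval : ∀ n, (P n fun _ => y) = ∑' k, e k * ((l k y) ^ n / n.factorial) := by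
      intro n
      have := (ContinuousMultilinearMap.apply ℝ (fun _ : Fin n => V) ℝ (fun _ => y)).map_tsum
        (hqs n).of_norm
      simp only [ContinuousMultilinearMap.apply_apply, smul_apply, hqv,
        smul_eq_mul] at this
      exact this
    have hS : Summable fun z : ι × ℕ => e z.1 * ((l z.1 y) ^ z.2 / z.2.factorial) := by
      refine Summable.of_norm_bounded hsum fun z => ?_
      rw [norm_mul, Real.norm_eq_abs, abs_of_pos (hepos _), norm_div, norm_pow]
      simp only [RCLike.norm_natCast]
      refine mul_le_mul_of_nonneg_left ?_ (hepos _).le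
      gcongr
      exact ((l z.1).le_opNorm y).trans (by gcongr)
    have hS' : Summable fun z : ℕ × ι => e z.2 * ((l z.2 y) ^ z.1 / z.1.factorial) :=
      hS.prod_symm
    simp only [hval]
    have h2 : ∑' n : ℕ, ∑' k, e k * ((l k y) ^ n / n.factorial) =
        ∑' k, Real.exp (l k (p + y) + a k) := by
      refine (Summable.tsum_comm (f := fun k (n : ℕ) => e k * ((l k y) ^ n / n.factorial))
        hS).trans ?_
      refine tsum_congr fun k => ?_
      have h3 : ∑' n : ℕ, (l k y) ^ n / n.factorial = Real.exp (l k y) := (hexp (l k y)).tsum_eq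
      rw [tsum_mul_left, h3, he, ← Real.exp_add, map_add]
      congr 1
      ring
    rw [← h2]
    exact hS'.prod.hasSum

section AffineFamily

variable {E : Type*} [NormedAddCommGroup E] [NormedSpace ℝ E] {K : Set E} {c e : E → ℝ} {b : ℝ}

theorem ConvexOn.exists_finset_affine_minorants (hK : IsCompact K) (hc : ConvexOn ℝ K c)
    (hcont : ContinuousOn c K) {η : ℝ} (hη : 0 < η) :
    ∃ S : Finset ((E →L[ℝ] ℝ) × ℝ), (∀ A ∈ S, ∀ x ∈ K, A.1 x + A.2 ≤ c x) ∧
      ∀ x ∈ K, ∃ A ∈ S, c x - η < A.1 x + A.2 := by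
  classical
  refine hK.induction_on (p := fun s => ∃ S : Finset ((E →L[ℝ] ℝ) × ℝ),
    (∀ A ∈ S, ∀ x ∈ K, A.1 x + A.2 ≤ c x) ∧ ∀ x ∈ s, ∃ A ∈ S, c x - η < A.1 x + A.2)
    ⟨∅, by simp⟩ ?_ ?_ ?_
  · rintro s t hst ⟨S, h1, h2⟩
    exact ⟨S, h1, fun x hx => h2 x (hst hx)⟩
  · rintro s t ⟨S, h1, h2⟩ ⟨T, h3, h4⟩
    refine ⟨S ∪ T, fun A hA => (Finset.mem_union.1 hA).elim (h1 A) (h3 A), ?_⟩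
    rintro x (hx | hx)
    · obtain ⟨A, hA, hA'⟩ := h2 x hx
      exact ⟨A, Finset.mem_union_left _ hA, hA'⟩
    · obtain ⟨A, hA, hA'⟩ := h4 x hx
      exact ⟨A, Finset.mem_union_right _ hA, hA'⟩
  · intro x hx
    obtain ⟨l, t, h1, h2⟩ := hc.exists_affine_le_of_lt (𝕜 := ℝ) hx (a := c x - η / 2)
      (by linarith) hK.isClosed hcont.lowerSemicontinuousOn
    simp only [RCLike.re_to_real] at h2
    refine ⟨{y | c y - η < l y + t}, ?_, {(l, t)}, ?_, ?_⟩
    · have : ContinuousWithinAt (fun y => l y + t - c y) K x :=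
        (by fun_prop : Continuous fun y => l y + t).continuousWithinAt.sub (hcont x hx)
      filter_upwards [this.eventually (lt_mem_nhds (show -η < l x + t - c x by linarith))]
        with y hy
      exact (show c y - η < l y + t by linarith)
    · intro A hA y hy
      rw [Finset.mem_singleton.1 hA]
      exact h1 ⟨y, hy⟩
    · intro y hy
      exact ⟨_, Finset.mem_singleton_self _, hy⟩

theorem exists_pos_mul_exp_neg_le (N : ℕ) {δ ρ w : ℝ} (hδ : 0 < δ) (hρ : 0 < ρ) (hw : 0 < w) :
    ∃ μ : ℝ, 0 < μ ∧ N * Real.exp (-(μ * δ)) ≤ w ∧ N * Real.exp (-(μ * ρ)) ≤ w := by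
  have key : ∀ δ : ℝ, 0 < δ → ∀ᶠ μ : ℝ in atTop, N * Real.exp (-(μ * δ)) ≤ w := by
    intro δ hδ
    have h1 : Tendsto (fun μ : ℝ => N * Real.exp (-(μ * δ))) atTop (𝓝 (N * 0)) :=
      (Real.tendsto_exp_neg_atTop_nhds_zero.comp (tendsto_id.atTop_mul_const hδ)).const_mul _
    rw [mul_zero] at h1
    filter_upwards [h1.eventually (gt_mem_nhds hw)] with μ hμ using hμ.le
  exact ((eventually_gt_atTop 0).and ((key δ hδ).and (key ρ hρ))).exists

/-- Finitely many affine functions lying above `c` somewhere at each point of the sublevel set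
`{c ≤ r}`, uniformly below `c + e` and below `c + ρ`. -/
theorem ConvexOn.exists_finset_affine_between (hK : IsCompact K) (hc : ConvexOn ℝ K c)
    (hcont : ContinuousOn c K) (he0 : ∀ x ∈ K, 0 ≤ e x)
    (he : ContinuousOn e {x ∈ K | c x < b}) (hepos : ∀ x ∈ K, c x < b → 0 < e x)
    {r r' ρ w : ℝ} (hr : r < r') (hr' : r' < b) (hρ : 0 < ρ) (hw : 0 < w) :
    ∃ (S : Finset ((E →L[ℝ] ℝ) × ℝ)) (μ δ : ℝ), 0 < μ ∧ 0 < δ ∧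
      (∀ A ∈ S, ∀ x ∈ K, A.1 x + A.2 ≤ c x + ρ) ∧
      (∀ A ∈ S, ∀ x ∈ K, A.1 x + A.2 + δ ≤ c x + e x) ∧
      S.card * Real.exp (-(μ * δ)) ≤ w ∧ S.card * Real.exp (-(μ * ρ)) ≤ w ∧
      ∀ x ∈ K, c x ≤ r → ∃ A ∈ S, c x < A.1 x + A.2 := by
  classical
  obtain ⟨m, hm⟩ : ∃ m, ∀ x ∈ K, m ≤ c x := by
    obtain ⟨m, hm⟩ := hK.bddBelow_image hcont
    exact ⟨m, fun x hx => hm (mem_image_of_mem _ hx)⟩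
  obtain ⟨e₀, he₀, hee⟩ : ∃ e₀ > 0, ∀ x ∈ K, c x ≤ r' → e₀ ≤ e x := by
    have hC : IsCompact {x ∈ K | c x ≤ r'} :=
      hK.of_isClosed_subset (hcont.preimage_isClosed_of_isClosed hK.isClosed isClosed_Iic)
        (fun x hx => hx.1)
    rcases {x ∈ K | c x ≤ r'}.eq_empty_or_nonempty with h0 | hne
    · refine ⟨1, one_pos, fun x hx hx' => ?_⟩
      exact absurd (show x ∈ {x ∈ K | c x ≤ r'} from ⟨hx, hx'⟩) (by simp [h0])
    · obtain ⟨z, hz, hz'⟩ := hC.exists_isMinOn hne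
        (he.mono fun x hx => ⟨hx.1, hx.2.trans_lt hr'⟩)
      exact ⟨e z, hepos z hz.1 (hz.2.trans_lt hr'), fun x hx hx' => hz' ⟨hx, hx'⟩⟩
  set D : ℝ := max (r' - m) 1 with hD
  have hD0 : 0 < D := lt_of_lt_of_le one_pos (le_max_right _ _)
  set σ : ℝ := min (1 / 2) (min ρ e₀ / D) with hσ
  have hσ0 : 0 < σ := lt_min (by norm_num) (div_pos (lt_min hρ he₀) hD0)
  have hσ1 : σ ≤ 1 / 2 := min_le_left _ _
  have hσD : σ * D ≤ min ρ e₀ := by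
    rw [← le_div_iff₀ hD0]
    exact min_le_right _ _
  set η : ℝ := σ * (r' - r) with hη
  have hη0 : 0 < η := mul_pos hσ0 (by linarith)
  have hup : ∀ x ∈ K, σ * (r' - c x) ≤ min ρ e₀ := fun x hx =>
    (mul_le_mul_of_nonneg_left ((by linarith [hm x hx] : r' - c x ≤ r' - m).trans
      (le_max_left _ _)) hσ0.le).trans hσD
  obtain ⟨T, hT1, hT2⟩ := hc.exists_finset_affine_minorants hK hcont (half_pos hη0)
  set φ : (E →L[ℝ] ℝ) × ℝ → (E →L[ℝ] ℝ) × ℝ :=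
    fun A => ((1 - σ) • A.1, (1 - σ) * A.2 + σ * r' - η / 2) with hφ
  have hφv : ∀ A x, (φ A).1 x + (φ A).2 = (1 - σ) * (A.1 x + A.2) + σ * r' - η / 2 := by
    intro A x
    simp only [hφ, smul_apply, smul_eq_mul]
    ring
  have hbase : ∀ A ∈ T.image φ, ∀ x ∈ K, A.1 x + A.2 + η / 2 ≤ c x + σ * (r' - c x) := by
    intro A hA x hx
    obtain ⟨B, hB, rfl⟩ := Finset.mem_image.1 hA
    rw [hφv]
    nlinarith [mul_le_mul_of_nonneg_left (hT1 B hB x hx) (by linarith : 0 ≤ 1 - σ)]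
  obtain ⟨μ, hμ, h1, h2⟩ := exists_pos_mul_exp_neg_le (T.image φ).card (half_pos hη0) hρ hw
  refine ⟨T.image φ, μ, η / 2, hμ, half_pos hη0, ?_, ?_, h1, h2, ?_⟩
  · intro A hA x hx
    have := hbase A hA x hx
    have := (hup x hx).trans (min_le_left _ _)
    linarith
  · intro A hA x hx
    refine (hbase A hA x hx).trans ?_
    gcongr
    rcases le_or_gt (c x) r' with h | h
    · exact ((hup x hx).trans (min_le_right _ _)).trans (hee x hx h)
    · exact (mul_nonpos_of_nonneg_of_nonpos hσ0.le (by linarith)).trans (he0 x hx)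
  · intro x hx hxr
    obtain ⟨A, hA, hA'⟩ := hT2 x hx
    refine ⟨φ A, Finset.mem_image_of_mem _ hA, ?_⟩
    rw [hφv]
    have h3 := mul_lt_mul_of_pos_left hA' (by linarith : 0 < 1 - σ)
    have h4 : η ≤ σ * (r' - c x) := mul_le_mul_of_nonneg_left (by linarith) hσ0.le
    have h5 := mul_pos hσ0 hη0
    nlinarith

theorem ConvexOn.exists_affine_family (hK : IsCompact K) (hc : ConvexOn ℝ K c)
    (hcont : ContinuousOn c K) (he0 : ∀ x ∈ K, 0 ≤ e x)
    (he : ContinuousOn e {x ∈ K | c x < b}) (hepos : ∀ x ∈ K, c x < b → 0 < e x) :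
    ∃ S : ℕ → Finset ((E →L[ℝ] ℝ) × ℝ), ∃ μ : (Σ j, S j) → ℝ, (∀ k, 0 < μ k) ∧
      (∀ x ∈ K, Summable (fun k : Σ j, S j =>
          Real.exp (μ k * (k.2.1.1 x + k.2.1.2 - (c x + e x)))) ∧
        ∑' k : Σ j, S j, Real.exp (μ k * (k.2.1.1 x + k.2.1.2 - (c x + e x))) ≤ 1 / 2) ∧
      (∀ x ∈ K, c x < b → ∃ k : Σ j, S j, c x < k.2.1.1 x + k.2.1.2) ∧
      ∀ κ > 0, ∃ u : (Σ j, S j) → ℝ, Summable u ∧ ∀ k, ∀ x ∈ K,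
        Real.exp (μ k * (k.2.1.1 x + k.2.1.2 - c x - κ)) ≤ u k := by
  have hstep := fun j : ℕ => hc.exists_finset_affine_between hK hcont he0 he hepos
    (r := b - 1 / ((j : ℝ) + 1)) (r' := b - 1 / ((j : ℝ) + 2)) (ρ := 1 / ((j : ℝ) + 1))
    (w := 1 / 4 / 2 ^ j) (sub_lt_sub_left (one_div_lt_one_div_of_lt (by positivity)
      (by linarith)) b) (sub_lt_self b (by positivity)) (by positivity) (by positivity)
  choose S μ δ hμ hδ h1 h2 h3 h4 h5 using hstep
  have hgeo : HasSum (fun j : ℕ => (1 / 4 : ℝ) / 2 ^ j) (1 / 2) := by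
    have h := hasSum_geometric_two' (1 / 2 : ℝ)
    rwa [show (1 / 2 : ℝ) / 2 = 1 / 4 by norm_num] at h
  have hsig : ∀ f : ℕ → ℝ, (∀ j, 0 ≤ f j) → Summable (fun j => (S j).card * f j) →
      Summable (fun k : Σ j, S j => f k.1) := by
    intro f hf hs
    rw [summable_sigma_of_nonneg fun k => hf k.1]
    refine ⟨fun j => Summable.of_finite, hs.congr fun j => ?_⟩
    simp
  refine ⟨S, fun k => μ k.1, fun k => hμ k.1, ?_, ?_, ?_⟩
  · intro x hx
    have hs0 : Summable fun j => ((S j).card : ℝ) * Real.exp (-(μ j * δ j)) :=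
      Summable.of_nonneg_of_le (fun j => by positivity) h3 hgeo.summable
    have hs1 := hsig (fun j => Real.exp (-(μ j * δ j))) (fun j => (Real.exp_pos _).le) hs0
    have hle : ∀ k : Σ j, S j, Real.exp (μ k.1 * (k.2.1.1 x + k.2.1.2 - (c x + e x))) ≤
        Real.exp (-(μ k.1 * δ k.1)) := by
      intro k
      rw [Real.exp_le_exp, ← mul_neg]
      exact mul_le_mul_of_nonneg_left (by linarith [h2 k.1 k.2.1 k.2.2 x hx]) (hμ _).le
    have hs2 := Summable.of_nonneg_of_le (fun k => (Real.exp_pos _).le) hle hs1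
    refine ⟨hs2, (hs2.tsum_le_tsum hle hs1).trans ?_⟩
    rw [hs1.tsum_sigma]
    refine le_trans (le_of_eq ?_) ((hs0.tsum_le_tsum h3 hgeo.summable).trans hgeo.tsum_eq.le)
    simp
  · intro x hx hxb
    obtain ⟨j, hj⟩ := exists_nat_one_div_lt (sub_pos.2 hxb)
    obtain ⟨A, hA, hA'⟩ := h5 j x hx (by linarith)
    exact ⟨⟨j, A, hA⟩, hA'⟩
  · intro κ hκ
    refine ⟨fun k => Real.exp (μ k.1 * (1 / ((k.1 : ℝ) + 1) - κ)), ?_, ?_⟩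
    · refine hsig (fun j => Real.exp (μ j * (1 / ((j : ℝ) + 1) - κ)))
        (fun j => (Real.exp_pos _).le) ?_
      refine hgeo.summable.of_norm_bounded_eventually_nat ?_
      have hlim : Tendsto (fun j : ℕ => 1 / ((j : ℝ) + 1)) atTop (𝓝 0) :=
        tendsto_one_div_add_atTop_nhds_zero_nat
      filter_upwards [hlim.eventually (gt_mem_nhds (half_pos hκ))] with j hj
      rw [Real.norm_of_nonneg (by positivity)]
      refine le_trans ?_ (h4 j)
      gcongr
      rw [← mul_neg]
      exact mul_le_mul_of_nonneg_left (by linarith) (hμ j).le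
    · intro k x hx
      rw [Real.exp_le_exp]
      exact mul_le_mul_of_nonneg_left (by linarith [h1 k.1 k.2.1 k.2.2 x hx]) (hμ _).le

end AffineFamily

section Implicit

variable {E : Type*} [NormedAddCommGroup E] [NormedSpace ℝ E] [CompleteSpace E]

theorem AnalyticAt.of_implicit {Φ : E × ℝ → ℝ} {g : E → ℝ} {p : E}
    (hΦ : AnalyticAt ℝ Φ (p, g p)) (hd : fderiv ℝ Φ (p, g p) (0, 1) ≠ 0)
    (huniq : ∀ᶠ v in 𝓝 (p, g p), Φ v = Φ (p, g p) → v.2 = g v.1) : AnalyticAt ℝ g p := by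
  have hC : ContDiffAt ℝ ⊤ Φ (p, g p) := hΦ.contDiffAt
  have hinv : (fderiv ℝ Φ (p, g p) ∘L .inr ℝ E ℝ).IsInvertible := by
    refine ⟨ContinuousLinearEquiv.unitsEquivAut ℝ (Units.mk0 _ hd), ?_⟩
    ext
    simp
  have hne : (⊤ : WithTop ℕ∞) ≠ 0 := by simp
  have h1 := hC.contDiffAt_implicitFunction hne hinv
  have h2 := hC.implicitFunction_apply_self hne hinv
  have h3 := hC.eventually_apply_implicitFunction hne hinv
  set ψ := hC.implicitFunction hne hinv
  have h4 : Tendsto (fun x => (x, ψ x)) (𝓝 p) (𝓝 (p, g p)) := by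
    have : ContinuousAt (fun x => (x, ψ x)) p := continuousAt_id.prodMk h1.continuousAt
    have h5 := this.tendsto
    simp only at h2
    rwa [h2] at h5
  refine h1.analyticAt.congr ?_
  filter_upwards [h3, h4.eventually huniq] with x hx hx'
  exact hx' hx

end Implicit

theorem ConvexOn.hasDerivAt_neg_of_lt {f : ℝ → ℝ} {a b f' : ℝ} (hf : ConvexOn ℝ (Icc a b) f)
    (hab : a < b) (hlt : f b < f a) (hd : HasDerivAt f f' a) : f' < 0 := by
  refine (hf.le_slope_of_hasDerivAt (left_mem_Icc.2 hab.le) (right_mem_Icc.2 hab.le) hab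
    hd).trans_lt ?_
  rw [slope_def_field]
  exact div_neg_of_neg_of_pos (by linarith) (by linarith)

theorem norm_sq_convexCombination {E : Type*} [NormedAddCommGroup E] [InnerProductSpace ℝ E]
    (x y : E) {a b : ℝ} (hab : a + b = 1) :
    ‖a • x + b • y‖ ^ 2 = a * ‖x‖ ^ 2 + b * ‖y‖ ^ 2 - a * b * ‖x - y‖ ^ 2 := by
  rw [norm_add_sq_real, norm_sub_sq_real, norm_smul, norm_smul, real_inner_smul_left,
    inner_smul_right, mul_pow, mul_pow, Real.norm_eq_abs, Real.norm_eq_abs, sq_abs, sq_abs]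
  obtain rfl := eq_sub_of_add_eq hab
  ring

section ExpSum

variable {E ι : Type*} [NormedAddCommGroup E] [InnerProductSpace ℝ E]
  {α : ι → E →L[ℝ] ℝ} {β μ : ι → ℝ} {η : ℝ}

/-- The exponential of `μ k` times the height of the affine function `α k + β k` above the point
`v` of `E × ℝ`. -/
noncomputable def expTerm (α : ι → E →L[ℝ] ℝ) (β μ : ι → ℝ) (v : E × ℝ) (k : ι) : ℝ :=
  Real.exp (μ k * (α k v.1 + β k - v.2))

/-- A sum of exponentials of affine functions on `E × ℝ`, plus a quadratic term in `E`. -/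
noncomputable def expSum (η : ℝ) (α : ι → E →L[ℝ] ℝ) (β μ : ι → ℝ) (v : E × ℝ) : ℝ :=
  η * ‖v.1‖ ^ 2 + ∑' k, expTerm α β μ v k

theorem expTerm_pos (v : E × ℝ) (k : ι) : 0 < expTerm α β μ v k := Real.exp_pos _

theorem expTerm_convex (v w : E × ℝ) (k : ι) {a b : ℝ} (ha : 0 ≤ a) (hb : 0 ≤ b)
    (hab : a + b = 1) :
    expTerm α β μ (a • v + b • w) k ≤ a * expTerm α β μ v k + b * expTerm α β μ w k := by
  have h := convexOn_exp.2 (mem_univ (μ k * (α k v.1 + β k - v.2)))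
    (mem_univ (μ k * (α k w.1 + β k - w.2))) ha hb hab
  refine (le_of_eq ?_).trans h
  obtain rfl := eq_sub_of_add_eq hab
  simp only [expTerm, Prod.fst_add, Prod.snd_add, Prod.smul_fst, Prod.smul_snd, map_add, map_smul,
    smul_eq_mul]
  congr 1
  ring

theorem expSum_convex {v w : E × ℝ} (hv : Summable (expTerm α β μ v))
    (hw : Summable (expTerm α β μ w)) {a b : ℝ} (ha : 0 ≤ a) (hb : 0 ≤ b) (hab : a + b = 1) :
    Summable (expTerm α β μ (a • v + b • w)) ∧
      expSum η α β μ (a • v + b • w) ≤ a * expSum η α β μ v + b * expSum η α β μ w -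
        η * (a * b * ‖v.1 - w.1‖ ^ 2) := by
  have hs := (hv.mul_left a).add (hw.mul_left b)
  have hs' := Summable.of_nonneg_of_le (fun k => (expTerm_pos _ k).le)
    (fun k => expTerm_convex v w k ha hb hab) hs
  refine ⟨hs', ?_⟩
  have h1 := hs'.tsum_le_tsum (fun k => expTerm_convex v w k ha hb hab) hs
  rw [(hv.mul_left a).tsum_add (hw.mul_left b), tsum_mul_left, tsum_mul_left] at h1
  have h2 := norm_sq_convexCombination v.1 w.1 hab
  simp only [expSum, Prod.fst_add, Prod.smul_fst]
  rw [h2]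
  linarith

theorem expTerm_lt (hμ : ∀ k, 0 < μ k) (x : E) {s t : ℝ} (hst : s < t) (k : ι) :
    expTerm α β μ (x, t) k < expTerm α β μ (x, s) k :=
  Real.exp_lt_exp.2 (mul_lt_mul_of_pos_left (sub_lt_sub_left hst _) (hμ k))

theorem expSum_lt [Nonempty ι] (hμ : ∀ k, 0 < μ k) {x : E} {s t : ℝ}
    (hs : Summable (expTerm α β μ (x, s))) (hst : s < t) :
    expSum η α β μ (x, t) < expSum η α β μ (x, s) := by
  have h := expTerm_lt (α := α) (β := β) hμ x hst
  refine add_lt_add_right (Summable.tsum_lt_tsum (i := Classical.arbitrary ι)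
    (fun k => (h k).le) (h _) ?_ hs) _
  exact Summable.of_nonneg_of_le (fun k => (expTerm_pos _ k).le) (fun k => (h k).le) hs

theorem analyticAt_expSum {x : E} {t : ℝ} {r : ℝ} (hr : 0 < r) {u : ι → ℝ} (hu : Summable u)
    (h : ∀ v ∈ closedBall (x, t) r, ∀ k, expTerm α β μ v k ≤ u k) :
    AnalyticAt ℝ (expSum η α β μ) (x, t) := by
  have h1 : AnalyticAt ℝ (fun v : E × ℝ => η * ‖v.1‖ ^ 2) (x, t) := by
    have : ContDiff ℝ ⊤ (fun v : E × ℝ => η * ‖v.1‖ ^ 2) :=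
      contDiff_const.mul ((contDiff_norm_sq ℝ).comp contDiff_fst)
    exact this.contDiffAt.analyticAt
  let l : ι → (E × ℝ) →L[ℝ] ℝ := fun k =>
    μ k • ((α k).comp (ContinuousLinearMap.fst ℝ E ℝ) - ContinuousLinearMap.snd ℝ E ℝ)
  have hl : ∀ v k, expTerm α β μ v k = Real.exp (l k v + μ k * β k) := by
    intro v k
    simp only [expTerm, l, smul_apply, sub_apply,
      ContinuousLinearMap.comp_apply, ContinuousLinearMap.coe_fst', ContinuousLinearMap.coe_snd',
      smul_eq_mul]
    congr 1
    ring
  have h2 := analyticAt_tsum_exp l (fun k => μ k * β k) (x, t) hr hu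
    (fun k v hv => (hl v k).symm.le.trans (h v hv k))
  refine (h1.add h2).congr (Eventually.of_forall fun v => ?_)
  simp only [expSum, hl, Pi.add_apply]

end ExpSum

section Approximation

variable {E : Type*} [NormedAddCommGroup E] [InnerProductSpace ℝ E] [FiniteDimensional ℝ E]

/-- A convex function on a compact set `K` whose maximum `b` is attained exactly outside an open
set can be approximated from above, in the fine topology of that open set, by a real analytic
and locally strongly convex function agreeing with it on the rest of `K`. -/
theorem ConvexOn.exists_analytic_approx {K : Set E} {c e : E → ℝ} {b : ℝ} (hK : IsCompact K)
    (hc : ConvexOn ℝ K c) (hcont : ContinuousOn c K) (hW : IsOpen {x ∈ K | c x < b})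
    (he : ContinuousOn e {x ∈ K | c x < b}) (hepos : ∀ x ∈ K, c x < b → 0 < e x) :
    ∃ g : E → ℝ, (∀ x ∈ K, c x < b → c x < g x ∧ g x ≤ c x + e x) ∧ (∀ x, ¬ (x ∈ K ∧ c x < b) →
      g x = c x) ∧ ConvexOn ℝ K g ∧ AnalyticOnNhd ℝ g {x ∈ K | c x < b} ∧
      ∀ p ∈ {x ∈ K | c x < b}, ∃ r > 0, ∃ m > 0, ball p r ⊆ {x ∈ K | c x < b} ∧
        StrongConvexOn (ball p r) m g := by
  classical
  set W : Set E := {x ∈ K | c x < b} with hWdef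
  set e' : E → ℝ := fun x => if x ∈ W then e x else 0 with he'
  have he'W : ∀ x ∈ W, e' x = e x := fun x hx => if_pos hx
  obtain ⟨S, μ, hμ, hF1, hF2, hF3⟩ := hc.exists_affine_family (e := e') (b := b) hK hcont
    (fun x hx => by
      by_cases h : x ∈ W
      · rw [he'W x h]; exact (hepos x h.1 h.2).le
      · exact (if_neg h).ge)
    (he.congr he'W) (fun x hx hxb => by rw [he'W x ⟨hx, hxb⟩]; exact hepos x hx hxb)
  set α : (Σ j, S j) → E →L[ℝ] ℝ := fun k => k.2.1.1
  set β : (Σ j, S j) → ℝ := fun k => k.2.1.2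
  obtain ⟨R, hR⟩ := hK.isBounded.exists_norm_le
  set η : ℝ := 1 / (2 * (R ^ 2 + 1)) with hη
  have hη0 : 0 < η := by positivity
  have hηK : ∀ x ∈ K, η * ‖x‖ ^ 2 ≤ 1 / 2 := by
    intro x hx
    have : ‖x‖ ^ 2 ≤ R ^ 2 + 1 := by nlinarith [hR x hx, norm_nonneg x]
    rw [hη, one_div_mul_eq_div, div_le_iff₀ (by positivity)]
    linarith
  set Φ : E × ℝ → ℝ := expSum η α β μ with hΦ
  have hΦ1 : ∀ x ∈ K, Summable (expTerm α β μ (x, c x + e' x)) ∧ Φ (x, c x + e' x) ≤ 1 := by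
    intro x hx
    refine ⟨(hF1 x hx).1, ?_⟩
    have h1 := (hF1 x hx).2
    have h2 := hηK x hx
    have h3 : Φ (x, c x + e' x) = η * ‖x‖ ^ 2 + ∑' k, expTerm α β μ (x, c x + e' x) k := rfl
    have h4 : ∑' k, expTerm α β μ (x, c x + e' x) k ≤ 1 / 2 := h1
    linarith
  have hloc : ∀ x ∈ W, ∀ t, c x < t → ∃ r > 0, ∃ u : (Σ j, S j) → ℝ, Summable u ∧
      ∀ v ∈ closedBall (x, t) r, ∀ k, expTerm α β μ v k ≤ u k := by
    intro x hx t ht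
    obtain ⟨u, hu, hu'⟩ := hF3 ((t - c x) / 2) (by linarith)
    have hcx : ContinuousAt c x :=
      (hcont x hx.1).continuousAt (mem_of_superset (hW.mem_nhds hx) fun y hy => hy.1)
    have h1 : ∀ᶠ v in 𝓝 (x, t), v.1 ∈ W ∧ c v.1 + (t - c x) / 2 < v.2 := by
      have h2 : ContinuousAt (fun v : E × ℝ => v.2 - c v.1) (x, t) :=
        continuousAt_snd.sub (hcx.comp (f := Prod.fst) (x := (x, t)) continuousAt_fst)
      filter_upwards [continuousAt_fst.preimage_mem_nhds (hW.mem_nhds hx),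
        h2.eventually (lt_mem_nhds (show (t - c x) / 2 < t - c x by linarith))] with v hv hv'
      exact ⟨hv, by linarith⟩
    obtain ⟨r, hr, hr'⟩ := nhds_basis_closedBall.mem_iff.1 h1
    refine ⟨r, hr, u, hu, fun v hv k => ?_⟩
    obtain ⟨h3, h4⟩ := hr' hv
    refine le_trans (Real.exp_le_exp.2 ?_) (hu' k v.1 h3.1)
    exact mul_le_mul_of_nonneg_left (by linarith) (hμ k).le
  have hsum : ∀ x ∈ W, ∀ t, c x < t → Summable (expTerm α β μ (x, t)) := by
    intro x hx t ht
    obtain ⟨r, hr, u, hu, h⟩ := hloc x hx t ht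
    exact Summable.of_nonneg_of_le (fun k => (expTerm_pos _ k).le)
      (h _ (mem_closedBall_self hr.le)) hu
  have han : ∀ x ∈ W, ∀ t, c x < t → AnalyticAt ℝ Φ (x, t) := by
    intro x hx t ht
    obtain ⟨r, hr, u, hu, h⟩ := hloc x hx t ht
    exact analyticAt_expSum hr hu h
  have hne : ∀ x ∈ W, Nonempty (Σ j, S j) := fun x hx => ⟨(hF2 x hx.1 hx.2).choose⟩
  have hlt : ∀ x ∈ W, ∀ s t, Summable (expTerm α β μ (x, s)) → s < t →
      Φ (x, t) < Φ (x, s) := by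
    intro x hx s t hs hst
    have := hne x hx
    exact expSum_lt hμ hs hst
  have hex : ∀ x ∈ W, ∃ t, c x < t ∧ t ≤ c x + e x ∧ Φ (x, t) = 1 := by
    intro x hx
    obtain ⟨k, hk⟩ := hF2 x hx.1 hx.2
    set t₁ : ℝ := α k x + β k with ht₁
    have h1 : 1 ≤ Φ (x, t₁) := by
      have h2 : expTerm α β μ (x, t₁) k = 1 := by simp [expTerm, ht₁]
      have h3 := (hsum x hx t₁ hk).le_tsum k fun j _ => (expTerm_pos _ j).le
      have h4 : 0 ≤ η * ‖x‖ ^ 2 := by positivity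
      have h5 : Φ (x, t₁) = η * ‖x‖ ^ 2 + ∑' k, expTerm α β μ (x, t₁) k := rfl
      linarith
    have h2 := hΦ1 x hx.1
    rw [he'W x hx] at h2
    have h3 : t₁ ≤ c x + e x := by
      by_contra! h
      linarith [hlt x hx _ _ h2.1 h]
    have h4 : ContinuousOn (fun t => Φ (x, t)) (Icc t₁ (c x + e x)) := fun t ht =>
      ((han x hx t (hk.trans_le ht.1)).continuousAt.comp (f := fun t => (x, t))
        (by fun_prop)).continuousWithinAt
    obtain ⟨t, ht, ht'⟩ := intermediate_value_Icc' h3 h4 ⟨h2.2, h1⟩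
    exact ⟨t, hk.trans_le ht.1, ht.2, ht'⟩
  choose! g₀ hg1 hg2 hg3 using hex
  set g : E → ℝ := fun x => if x ∈ W then g₀ x else c x with hg
  have hgW : ∀ x ∈ W, g x = g₀ x := fun x hx => if_pos hx
  have hgc : ∀ x, x ∉ W → g x = c x := fun x hx => if_neg hx
  have hcg : ∀ x ∈ W, c x < g x := fun x hx => (hgW x hx).symm ▸ hg1 x hx
  have hgΦ : ∀ x ∈ W, Φ (x, g x) = 1 := fun x hx => (hgW x hx).symm ▸ hg3 x hx
  have hgle : ∀ x, c x ≤ g x := fun x => by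
    by_cases h : x ∈ W
    · exact (hcg x h).le
    · exact (hgc x h).ge
  have hgK : ∀ x ∈ K, Summable (expTerm α β μ (x, g x)) ∧ Φ (x, g x) ≤ 1 := by
    intro x hx
    by_cases h : x ∈ W
    · exact ⟨hsum x h _ (hcg x h), (hgΦ x h).le⟩
    · have := hΦ1 x hx
      rw [show e' x = 0 from if_neg h, add_zero] at this
      rwa [hgc x h]
  have huniq : ∀ x ∈ W, ∀ t, c x < t → Φ (x, t) = 1 → t = g x := by
    intro x hx t ht h1
    rcases lt_trichotomy t (g x) with h | h | h
    · linarith [hlt x hx _ _ (hsum x hx t ht) h, hgΦ x hx]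
    · exact h
    · linarith [hlt x hx _ _ (hsum x hx _ (hcg x hx)) h, hgΦ x hx]
  have hconv : ConvexOn ℝ K g := by
    refine ⟨hc.1, fun x hx y hy a b' ha hb hab => ?_⟩
    simp only [smul_eq_mul]
    have hz := hc.1 hx hy ha hb hab
    by_cases h : a • x + b' • y ∈ W
    · by_contra! hcon
      obtain ⟨h1, h2⟩ := expSum_convex (η := η) (hgK x hx).1 (hgK y hy).1 ha hb hab
      have h3 : Φ (a • x + b' • y, g (a • x + b' • y)) <
          Φ (a • x + b' • y, a * g x + b' * g y) := hlt _ h _ _ h1 hcon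
      rw [hgΦ _ h] at h3
      have h4 : 0 ≤ η * (a * b' * ‖x - y‖ ^ 2) := by positivity
      have h5 := mul_le_mul_of_nonneg_left (hgK x hx).2 ha
      have h6 := mul_le_mul_of_nonneg_left (hgK y hy).2 hb
      have h7 : Φ (a • x + b' • y, a * g x + b' * g y) ≤
          a * Φ (x, g x) + b' * Φ (y, g y) - η * (a * b' * ‖x - y‖ ^ 2) := h2
      linarith
    · rw [hgc _ h]
      have := hc.2 hx hy ha hb hab
      simp only [smul_eq_mul] at this
      nlinarith [hgle x, hgle y]
  have hgan : AnalyticOnNhd ℝ g W := by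
    intro p hp
    refine AnalyticAt.of_implicit (han p hp _ (hcg p hp)) (ne_of_lt ?_) ?_
    · have hd := (han p hp _ (hcg p hp)).differentiableAt.hasFDerivAt
      have hl : HasDerivAt (fun t : ℝ => ((p, t) : E × ℝ)) (0, 1) (g p) :=
        (hasDerivAt_const _ _).prodMk (hasDerivAt_id _)
      refine ConvexOn.hasDerivAt_neg_of_lt (a := g p) (b := g p + 1)
        ⟨convex_Icc _ _, fun s hs t ht a b' ha hb hab => ?_⟩ (by linarith)
        (hlt p hp _ _ (hgK p hp.1).1 (by linarith)) (hd.comp_hasDerivAt (g p) hl)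
      have h1 := (expSum_convex (η := η) (hsum p hp s ((hcg p hp).trans_le hs.1))
        (hsum p hp t ((hcg p hp).trans_le ht.1)) ha hb hab).2
      simpa [← add_smul, hab] using h1
    · have hcp : ContinuousAt c p :=
        (hcont p hp.1).continuousAt (mem_of_superset (hW.mem_nhds hp) fun y hy => hy.1)
      have h2 : ContinuousAt (fun v : E × ℝ => v.2 - c v.1) (p, g p) :=
        continuousAt_snd.sub (hcp.comp (f := Prod.fst) (x := (p, g p)) continuousAt_fst)
      filter_upwards [continuousAt_fst.preimage_mem_nhds (hW.mem_nhds hp),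
        h2.eventually (lt_mem_nhds (sub_pos.2 (hcg p hp)))] with v hv hv' hv''
      rw [hgΦ p hp] at hv''
      exact huniq v.1 hv v.2 (by linarith) hv''
  refine ⟨g, fun x hx hxb => ⟨hcg x ⟨hx, hxb⟩, ?_⟩, hgc, hconv, hgan, ?_⟩
  · rw [hgW x ⟨hx, hxb⟩]
    exact hg2 x ⟨hx, hxb⟩
  intro p hp
  obtain ⟨L, N, hN, hL⟩ := ((han p hp _ (hcg p hp)).contDiffAt (n := 1)).exists_lipschitzOnWith
  obtain ⟨ρ, hρ, hρN⟩ := Metric.mem_nhds_iff.1 hN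
  have hev : ∀ᶠ x in 𝓝 p, x ∈ W ∧ x ∈ ball p ρ ∧ g x ∈ ball (g p) ρ :=
    (hW.eventually_mem hp).and ((isOpen_ball.eventually_mem (mem_ball_self hρ)).and
      ((hgan p hp).continuousAt.eventually (isOpen_ball.eventually_mem (mem_ball_self hρ))))
  obtain ⟨r, hr, hrN⟩ := Metric.mem_nhds_iff.1 hev
  refine ⟨r, hr, 2 * (η / (L + 1)), by positivity, fun x hx => (hrN hx).1,
    convex_ball p r, fun x hx y hy a b' ha hb hab => ?_⟩
  have hz := convex_ball p r hx hy ha hb hab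
  set z := a • x + b' • y
  set T := a • g x + b' • g y with hT
  have hzT : (z, T) ∈ N := hρN <| by
    rw [← ball_prod_same]
    exact ⟨(hrN hz).2.1, convex_ball _ _ (hrN hx).2.2 (hrN hy).2.2 ha hb hab⟩
  have hzg : (z, g z) ∈ N := hρN <| by
    rw [← ball_prod_same]
    exact ⟨(hrN hz).2.1, (hrN hz).2.2⟩
  have h1 := (expSum_convex (η := η) (hgK x (hrN hx).1.1).1 (hgK y (hrN hy).1.1).1 ha hb hab).2
  have h2 : Φ (z, T) ≤ a * Φ (x, g x) + b' * Φ (y, g y) - η * (a * b' * ‖x - y‖ ^ 2) := h1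
  rw [hgΦ x (hrN hx).1, hgΦ y (hrN hy).1] at h2
  have h3 : g z ≤ T := hconv.2 (hrN hx).1.1 (hrN hy).1.1 ha hb hab
  have h4 := hL.dist_le_mul _ hzg _ hzT
  rw [hgΦ z (hrN hz).1, Prod.dist_eq, dist_self, Real.dist_eq, Real.dist_eq,
    abs_sub_comm (g z), abs_of_nonneg (sub_nonneg.2 h3), max_eq_right (sub_nonneg.2 h3)] at h4
  have h5 := (le_abs_self _).trans h4
  have h6 : η * (a * b' * ‖x - y‖ ^ 2) ≤ (L + 1) * (T - g z) := by nlinarith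
  have h7 : η / (L + 1) * (a * b' * ‖x - y‖ ^ 2) ≤ T - g z := by
    rw [div_mul_eq_mul_div, div_le_iff₀ (by positivity)]
    linarith
  change g z ≤ T - a * b' * (2 * (η / (L + 1)) / 2 * ‖x - y‖ ^ 2)
  linarith

end Approximation

section Gluing

variable {E : Type*} [NormedAddCommGroup E] [NormedSpace ℝ E] {U : Set E} {c F f : E → ℝ} {b : ℝ}

theorem interior_sublevel_eq (hU : IsOpen U) (hc : ConvexOn ℝ U c) (hcont : ContinuousOn c U)
    (hb : ∃ x ∈ U, c x < b) :
    interior {x ∈ U | c x ≤ b} = {x ∈ {x ∈ U | c x ≤ b} | c x < b} := by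
  apply subset_antisymm
  · intro x hx
    have hxK := interior_subset hx
    refine ⟨hxK, lt_of_le_of_ne hxK.2 fun hxb => ?_⟩
    obtain ⟨x₀, hx₀, hlt⟩ := hb
    have hcts : ContinuousAt (fun s : ℝ => x + s • (x - x₀)) 0 := by fun_prop
    have h1 : ∀ᶠ s in 𝓝[>] (0 : ℝ), x + s • (x - x₀) ∈ {x ∈ U | c x ≤ b} := by
      refine (hcts.eventually ?_).filter_mono nhdsWithin_le_nhds
      simp only [zero_smul, add_zero]
      exact mem_interior_iff_mem_nhds.1 hx
    obtain ⟨s, hs, hs0⟩ := (h1.and self_mem_nhdsWithin).exists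
    have hs0' : 0 < s := hs0
    have hmem : x ∈ openSegment ℝ x₀ (x + s • (x - x₀)) := by
      refine ⟨s / (1 + s), 1 / (1 + s), by positivity, by positivity, by field_simp; ring, ?_⟩
      have : (1 + s) ≠ 0 := by positivity
      match_scalars <;> field_simp <;> ring
    have := hc.lt_right_of_left_lt hx₀ hs.1 hmem (hxb ▸ hlt)
    linarith [hs.2]
  · have : {x ∈ {x ∈ U | c x ≤ b} | c x < b} = U ∩ c ⁻¹' Iio b := by
      ext x
      exact ⟨fun h => ⟨h.1.1, h.2⟩, fun h => ⟨⟨h.1, le_of_lt h.2⟩, h.2⟩⟩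
    exact interior_maximal (fun x hx => hx.1)
      (this ▸ hcont.isOpen_inter_preimage hU isOpen_Iio)

theorem ConvexOn.of_convexOn_sublevel (hc : ConvexOn ℝ U c) (hcont : ContinuousOn c U)
    (hle : ∀ x, c x ≤ F x) (heq : ∀ x ∈ U, b ≤ c x → F x = c x)
    (hF : ConvexOn ℝ {x ∈ U | c x ≤ b} F) : ConvexOn ℝ U F := by
  have key : ∀ z ∈ U, c z < b → ∀ x ∈ U, ∃ τ : ℝ, 0 < τ ∧
      z + τ • (x - z) ∈ {x ∈ U | c x ≤ b} ∧ F (z + τ • (x - z)) - F z ≤ τ * (F x - F z) := by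
    intro z hz hzb x hx
    rcases le_or_gt (c x) b with hxb | hxb
    · exact ⟨1, one_pos, by simp [hx, hxb], by simp⟩
    · have hmem : ∀ τ ∈ Icc (0 : ℝ) 1, z + τ • (x - z) ∈ U := fun τ hτ =>
        hc.1.add_smul_sub_mem hz hx hτ
      have h1 : ContinuousOn (fun τ : ℝ => c (z + τ • (x - z))) (Icc 0 1) :=
        hcont.comp (by fun_prop) hmem
      obtain ⟨τ, hτ, hτb⟩ := intermediate_value_Icc zero_le_one h1
        (show b ∈ Icc _ _ from ⟨by simpa using hzb.le, by simpa using hxb.le⟩)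
      simp only at hτb
      have hτ0 : 0 < τ := lt_of_le_of_ne hτ.1 (by rintro rfl; simp at hτb; linarith)
      refine ⟨τ, hτ0, ⟨hmem τ hτ, hτb.le⟩, ?_⟩
      rw [heq _ (hmem τ hτ) hτb.ge]
      have h2 := hc.2 hz hx (sub_nonneg.2 hτ.2) hτ.1 (by ring)
      rw [show (1 - τ) • z + τ • x = z + τ • (x - z) by module] at h2
      simp only [smul_eq_mul] at h2
      nlinarith [hle z, hle x, hτ.2]
  refine ⟨hc.1, fun x hx y hy a a' ha ha' haa => ?_⟩
  have hz := hc.1 hx hy ha ha' haa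
  set z := a • x + a' • y with hzdef
  simp only [smul_eq_mul]
  rcases le_or_gt b (c z) with hzb | hzb
  · rw [heq z hz hzb]
    have := hc.2 hx hy ha ha' haa
    simp only [smul_eq_mul] at this
    nlinarith [hle x, hle y]
  · obtain ⟨τ, hτ, hxK, hxF⟩ := key z hz hzb x hx
    obtain ⟨τ', hτ', hyK, hyF⟩ := key z hz hzb y hy
    set D := a / τ + a' / τ' with hD
    have hD0 : 0 < D := by
      rcases ha.lt_or_eq with h | h
      · have := div_pos h hτ
        have := div_nonneg ha' hτ'.le
        linarith
      · have h1 : 0 < a' := by linarith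
        have := div_pos h1 hτ'
        have := div_nonneg ha hτ.le
        linarith
    have h1 := hF.2 hxK hyK (show 0 ≤ a / τ / D by positivity)
      (show 0 ≤ a' / τ' / D by positivity) (by rw [← add_div]; exact div_self hD0.ne')
    have h2 : (a / τ / D) • (z + τ • (x - z)) + (a' / τ' / D) • (z + τ' • (y - z)) = z := by
      have h3 : (a / τ / D) • (z + τ • (x - z)) + (a' / τ' / D) • (z + τ' • (y - z)) =
          ((a / τ / D) + (a' / τ' / D)) • z + D⁻¹ • ((a / τ * τ) • (x - z) +
            (a' / τ' * τ') • (y - z)) := by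
        simp only [div_eq_mul_inv]
        module
      rw [h3, ← add_div, div_self hD0.ne', div_mul_cancel₀ _ hτ.ne', div_mul_cancel₀ _ hτ'.ne']
      have h4 : a • (x - z) + a' • (y - z) = 0 := by
        rw [show a • (x - z) + a' • (y - z) = (a • x + a' • y) - (a + a') • z by module, haa,
          ← hzdef, one_smul, sub_self]
      rw [h4, smul_zero, add_zero, one_smul]
    rw [h2] at h1
    simp only [smul_eq_mul] at h1
    have h1 := h1.trans_eq (show _ = (a / τ * F (z + τ • (x - z)) +
      a' / τ' * F (z + τ' • (y - z))) / D by ring)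
    rw [le_div_iff₀ hD0] at h1
    have h5 : a / τ * (F (z + τ • (x - z)) - F z) ≤ a * (F x - F z) :=
      (mul_le_mul_of_nonneg_left hxF (div_nonneg ha hτ.le)).trans
        (by rw [← mul_assoc, div_mul_cancel₀ _ hτ.ne'])
    have h6 : a' / τ' * (F (z + τ' • (y - z)) - F z) ≤ a' * (F y - F z) :=
      (mul_le_mul_of_nonneg_left hyF (div_nonneg ha' hτ'.le)).trans
        (by rw [← mul_assoc, div_mul_cancel₀ _ hτ'.ne'])
    have h7 : F z * D = a / τ * F z + a' / τ' * F z := by rw [hD]; ring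
    have h8 : a * F z + a' * F z = F z := by rw [← add_mul, haa, one_mul]
    linarith

theorem le_of_le_add_sq (hf : ConvexOn ℝ U f) {x y : E} (hx : x ∈ U) (hy : y ∈ U)
    (h : ∀ y ∈ U, F y ≤ f y + ‖y - x‖ ^ 2) (heq : F x = f x) {ζ : E →L[ℝ] ℝ}
    (hζ : ∀ y ∈ U, ζ (y - x) ≤ F y - F x) : ζ (y - x) ≤ f y - f x := by
  refine le_of_forall_pos_le_add fun δ hδ => ?_
  set q := ‖y - x‖ ^ 2 with hq
  have hq0 : 0 ≤ q := by positivity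
  set s := min 1 (δ / (q + 1)) with hs
  have hs0 : 0 < s := lt_min one_pos (by positivity)
  have hs1 : s ≤ 1 := min_le_left _ _
  have hsq : s * q ≤ δ := by
    have h1 : s ≤ δ / (q + 1) := min_le_right _ _
    rw [le_div_iff₀ (by positivity)] at h1
    nlinarith
  have hmem : x + s • (y - x) ∈ U := hf.1.add_smul_sub_mem hx hy ⟨hs0.le, hs1⟩
  have h1 := hζ _ hmem
  have h2 := h _ hmem
  have h3 := hf.2 hx hy (sub_nonneg.2 hs1) hs0.le (by ring)
  rw [show (1 - s) • x + s • y = x + s • (y - x) by module] at h3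
  simp only [smul_eq_mul] at h3
  rw [add_sub_cancel_left] at h1 h2
  rw [map_smul, smul_eq_mul] at h1
  rw [norm_smul, mul_pow, Real.norm_of_nonneg hs0.le, ← hq] at h2
  have h4 : s * ζ (y - x) ≤ s * (f y - f x + δ) := by nlinarith
  exact le_of_mul_le_mul_left h4 hs0

theorem ConvexOn.add_fderiv_le (hF : ConvexOn ℝ U F) {x y : E} (hx : x ∈ U)
    (hy : y ∈ U) {F' : E →L[ℝ] ℝ} (hd : HasFDerivAt F F' x) : F x + F' (y - x) ≤ F y := by
  have hline : HasDerivAt (fun s : ℝ => F (x + s • (y - x))) (F' (y - x)) 0 := by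
    have h1 : HasDerivAt (fun s : ℝ => x + s • (y - x)) (y - x) 0 := by
      simpa using ((hasDerivAt_id (0 : ℝ)).smul_const (y - x)).const_add x
    have h2 : HasFDerivAt F F' (x + (0 : ℝ) • (y - x)) := by simpa using hd
    exact h2.comp_hasDerivAt (0 : ℝ) h1
  have hcv : ConvexOn ℝ (Icc (0 : ℝ) 1) fun s : ℝ => F (x + s • (y - x)) := by
    refine ⟨convex_Icc _ _, fun s hs t ht a b ha hb hab => ?_⟩
    have h1 := hF.2 (hF.1.add_smul_sub_mem hx hy hs) (hF.1.add_smul_sub_mem hx hy ht) ha hb hab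
    refine (congrArg F ?_).trans_le h1
    obtain rfl := eq_sub_of_add_eq hab
    simp only [smul_eq_mul]
    module
  have h := hcv.le_slope_of_hasDerivAt (left_mem_Icc.2 zero_le_one) (right_mem_Icc.2 zero_le_one)
    zero_lt_one hline
  simp [slope_def_field, -map_sub] at h
  linarith

/-- A differentiable convex function on an open set is continuously differentiable. -/
theorem ConvexOn.contDiffOn_one (hU : IsOpen U) (hF : ConvexOn ℝ U F)
    (hd : ∀ x ∈ U, DifferentiableAt ℝ F x) : ContDiffOn ℝ 1 F U := by
  rw [show (1 : WithTop ℕ∞) = 0 + 1 by simp, contDiffOn_succ_iff_fderiv_of_isOpen hU]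
  refine ⟨fun x hx => (hd x hx).differentiableWithinAt, by simp, ?_⟩
  rw [contDiffOn_zero]
  intro x₀ hx₀
  refine ContinuousAt.continuousWithinAt (Metric.continuousAt_iff'.2 fun ε hε => ?_)
  have h1 := (hd x₀ hx₀).hasFDerivAt.isLittleO.bound (show 0 < ε / 8 by positivity)
  obtain ⟨r, hr, hrN⟩ := Metric.mem_nhds_iff.1 ((hU.eventually_mem hx₀).and h1)
  filter_upwards [ball_mem_nhds x₀ (show 0 < r / 4 by positivity)] with x hx
  rw [mem_ball, dist_eq_norm] at hx
  have hxU : x ∈ U := (hrN (show x ∈ ball x₀ r by rw [mem_ball, dist_eq_norm]; linarith)).1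
  rw [dist_eq_norm]
  refine lt_of_le_of_lt (b := ε / 2) ?_ (by linarith)
  have hbd : ∀ v ∈ closedBall (0 : E) (r / 2),
      (fderiv ℝ F x - fderiv ℝ F x₀) v ≤ ε / 8 * r := by
    intro v hv
    rw [mem_closedBall_zero_iff] at hv
    have hn : ‖x + v - x₀‖ < r := by
      rw [add_sub_right_comm]
      exact (norm_add_le _ _).trans_lt (by linarith)
    obtain ⟨h2, h3⟩ := hrN (show x + v ∈ ball x₀ r by rw [mem_ball, dist_eq_norm]; exact hn)
    have h4 := (le_abs_self _).trans (h3 : |_| ≤ _)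
    have h5 := hF.add_fderiv_le hxU h2 (hd x hxU).hasFDerivAt
    have h6 := hF.add_fderiv_le hx₀ hxU (hd x₀ hx₀).hasFDerivAt
    rw [add_sub_cancel_left] at h5
    rw [add_sub_right_comm, map_add] at h4
    rw [← add_sub_right_comm] at h4
    have h7 : ε / 8 * ‖x + v - x₀‖ ≤ ε / 8 * r := by gcongr
    rw [sub_apply]
    linarith
  have h := ContinuousLinearMap.opNorm_bound_of_ball_bound (half_pos hr) (ε / 8 * r)
    (fderiv ℝ F x - fderiv ℝ F x₀) (fun v hv => by
      rw [Real.norm_eq_abs, abs_le']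
      refine ⟨hbd v hv, ?_⟩
      have := hbd (-v) (by simpa using hv)
      rwa [map_neg] at this)
  refine h.trans ?_
  rw [div_le_iff₀ (half_pos hr)]
  nlinarith

theorem DifferentiableAt.of_le_of_le_add_sq {x : E} (hf : DifferentiableAt ℝ f x)
    (h : ∀ᶠ y in 𝓝 x, f y ≤ F y ∧ F y ≤ f y + ‖y - x‖ ^ 2) : DifferentiableAt ℝ F x := by
  have h1 : (fun y => F y - f y) =O[𝓝 x] fun y => ‖y - x‖ ^ 2 := by
    refine Asymptotics.IsBigO.of_bound 1 ?_
    filter_upwards [h] with y hy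
    rw [one_mul, Real.norm_of_nonneg (sub_nonneg.2 hy.1), Real.norm_of_nonneg (by positivity)]
    linarith [hy.2]
  have h2 := (h1.hasFDerivAt (by norm_num)).differentiableAt.add hf
  refine h2.congr_of_eventuallyEq (Eventually.of_forall fun y => ?_)
  simp

end Gluing

theorem exists_continuousOn_le_sq_dist {E : Type*} [NormedAddCommGroup E] {V : Set E} (hV : IsOpen V) {ε : E → ℝ}
    (hε : ContinuousOn ε V) (hpos : ∀ x ∈ V, 0 < ε x) :
    ∃ e : E → ℝ, ContinuousOn e V ∧ (∀ x ∈ V, 0 < e x) ∧ (∀ x ∈ V, e x ≤ ε x) ∧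
      ∀ y ∈ V, ∀ x ∉ V, e y ≤ ‖y - x‖ ^ 2 := by
  rcases Vᶜ.eq_empty_or_nonempty with h | h
  · exact ⟨ε, hε, hpos, fun _ _ => le_rfl, fun y _ x hx =>
      absurd (show x ∈ Vᶜ from hx) (by simp [h])⟩
  · refine ⟨fun y => min (ε y) (infDist y Vᶜ ^ 2), hε.inf (by fun_prop), fun x hx => ?_,
      fun x _ => min_le_left _ _, fun y _ x hx => (min_le_right _ _).trans ?_⟩
    · refine lt_min (hpos x hx) (pow_pos ?_ 2)
      exact (hV.isClosed_compl.notMem_iff_infDist_pos h).1 (by simpa using hx)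
    · rw [← dist_eq_norm]
      exact pow_le_pow_left₀ infDist_nonneg (infDist_le_dist_of_mem hx) 2

theorem isC2StronglyConvexOn_norm_sq {d : ℕ} (W : Set (EuclideanSpace ℝ (Fin d))) {m : ℝ}
    (hm : 0 < m) : IsC2StronglyConvexOn W fun x => m / 2 * ‖x‖ ^ 2 := by
  refine ⟨(contDiff_const.mul (contDiff_norm_sq ℝ)).contDiffOn, fun x _ v hv => ?_⟩
  have h1 : fderiv ℝ (fun x : EuclideanSpace ℝ (Fin d) => m / 2 * ‖x‖ ^ 2) =
      ⇑(m • innerSL ℝ) := by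
    ext x w
    have := ((hasStrictFDerivAt_norm_sq x).hasFDerivAt).const_mul (m / 2)
    rw [this.fderiv]
    simp
    ring
  rw [h1]
  have h2 : HasFDerivAt (⇑(m • innerSL ℝ : EuclideanSpace ℝ (Fin d) →L[ℝ] _ →L[ℝ] ℝ))
      (m • innerSL ℝ) x := ContinuousLinearMap.hasFDerivAt _
  rw [h2.fderiv]
  change 0 < m * inner ℝ v v
  exact mul_pos hm (real_inner_self_pos.2 hv)

theorem mainTheorem9 (d : ℕ) (U : Set (EuclideanSpace ℝ (Fin d)))
    (hUopen : IsOpen U) (hUconv : Convex ℝ U)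
    (f c : EuclideanSpace ℝ (Fin d) → ℝ) (ℓ : EuclideanSpace ℝ (Fin d) →ₗ[ℝ] ℝ)
    (hf : ConvexOn ℝ U f) (hfc : ∀ x ∈ U, f x = ℓ x + c x) (hc : IsProperOn U c)
    (b : ℝ) (hb : ∃ x ∈ U, c x < b)
    (K : Set (EuclideanSpace ℝ (Fin d))) (hK : K = {x ∈ U | c x ≤ b})
    (hKcompact : IsCompact K) (hKint : (interior K).Nonempty)
    (ε : EuclideanSpace ℝ (Fin d) → ℝ) (hεcont : ContinuousOn ε (interior K))
    (hεpos : ∀ x ∈ interior K, 0 < ε x) :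
    ∃ F : EuclideanSpace ℝ (Fin d) → ℝ,
      ConvexOn ℝ U F ∧
      (∀ x ∈ U \ interior K, F x = f x) ∧
      (∀ x ∈ interior K, |F x - f x| ≤ ε x) ∧
      (IsStronglyConvexOn (interior K) F ∧ AnalyticOnNhd ℝ F (interior K)) ∧
      (∀ x ∈ frontier K, subdifferentialOn U F x = subdifferentialOn U f x) ∧
      (IsC1AtPointsOf (U \ interior K) f → ContDiffOn ℝ 1 F U) := by
  have hℓc : Continuous ℓ := ℓ.continuous_of_finiteDimensional
  have hcconv : ConvexOn ℝ U c := by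
    refine (hf.sub (ℓ.concaveOn hUconv)).congr fun x hx => ?_
    simp [hfc x hx]
  have hccont : ContinuousOn c U := hcconv.continuousOn hUopen
  have hKU : K ⊆ U := fun x hx => (hK ▸ hx : x ∈ {x ∈ U | c x ≤ b}).1
  have hint : interior K = {x ∈ K | c x < b} := by
    rw [hK]
    exact interior_sublevel_eq hUopen hcconv hccont hb
  obtain ⟨e, hecont, hepos, heε, hesq⟩ :=
    exists_continuousOn_le_sq_dist isOpen_interior hεcont hεpos
  obtain ⟨g, hg1, hg2, hg3, hg4, hg5⟩ := (hcconv.subset hKU (by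
      rw [hK]; exact hcconv.convex_le b)).exists_analytic_approx (e := e) (b := b) hKcompact
    (hccont.mono hKU) (hint ▸ isOpen_interior) (hint ▸ hecont)
    (fun x hx hxb => hepos x (hint ▸ ⟨hx, hxb⟩))
  rw [← hint] at hg4 hg5
  have hgV : ∀ x ∈ interior K, c x < g x ∧ g x ≤ c x + e x := fun x hx => by
    rw [hint] at hx
    exact hg1 x hx.1 hx.2
  have hgc : ∀ x ∉ interior K, g x = c x := fun x hx => hg2 x (by rwa [hint] at hx)
  have hgle : ∀ x, c x ≤ g x := fun x => by
    by_cases h : x ∈ interior K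
    · exact (hgV x h).1.le
    · exact (hgc x h).ge
  have hgconv : ConvexOn ℝ U g := hcconv.of_convexOn_sublevel (b := b) hccont hgle
    (fun x _ hxb => hg2 x fun h => absurd h.2 (not_lt.2 hxb)) (hK ▸ hg3)
  set F : EuclideanSpace ℝ (Fin d) → ℝ := fun x => ℓ x + g x with hF
  have hFconv : ConvexOn ℝ U F := (ℓ.convexOn hUconv).add hgconv
  have hFf : ∀ x ∈ U \ interior K, F x = f x := fun x hx => by
    rw [hfc x hx.1, hF]
    simp only [hgc x hx.2]
  have hFle : ∀ x ∈ U, f x ≤ F x := fun x hx => by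
    rw [hfc x hx]
    exact add_le_add_right (hgle x) _
  have hFsq : ∀ x ∉ interior K, ∀ y ∈ U, F y ≤ f y + ‖y - x‖ ^ 2 := fun x hx y hy => by
    by_cases h : y ∈ interior K
    · rw [hfc y hy]
      have := (hgV y h).2.trans (add_le_add_right (hesq y h x hx) _)
      simp only [hF]
      linarith
    · rw [hFf y ⟨hy, h⟩]
      exact le_add_of_nonneg_right (by positivity)
  have hℓan : ∀ x, AnalyticAt ℝ ℓ x := fun x =>
    (ℓ.toContinuousLinearMap : EuclideanSpace ℝ (Fin d) →L[ℝ] ℝ).analyticAt x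
  have hFan : AnalyticOnNhd ℝ F (interior K) := fun x hx => (hℓan x).add (hg4 x hx)
  refine ⟨F, hFconv, hFf, fun x hx => ?_, ⟨fun p hp => ?_, hFan⟩, fun x hx => ?_, fun hC1 => ?_⟩
  · have hxU := hKU (interior_subset hx)
    have h1 := hgV x hx
    rw [abs_of_nonneg (sub_nonneg.2 (hFle x hxU)), hfc x hxU]
    simp only [hF]
    linarith [heε x hx]
  · obtain ⟨r, hr, m, hm, hsub, hsc⟩ := hg5 p hp
    refine ⟨ball p r, isOpen_ball, mem_ball_self hr, hsub, fun x => m / 2 * ‖x‖ ^ 2,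
      isC2StronglyConvexOn_norm_sq _ hm, ?_⟩
    refine ((ℓ.convexOn (convex_ball p r)).add (strongConvexOn_iff_convex.1 hsc)).congr
      fun x _ => ?_
    simp only [Pi.add_apply, hF]
    ring
  · have hxU : x ∈ U := hKU (hKcompact.isClosed.frontier_subset hx)
    have hxV : x ∉ interior K := hx.2
    have heq := hFf x ⟨hxU, hxV⟩
    ext ζ
    refine ⟨fun h y hy => le_of_le_add_sq hf hxU hy (hFsq x hxV) heq h, fun h y hy => ?_⟩
    have := h y hy
    linarith [hFle y hy]
  · refine hFconv.contDiffOn_one hUopen fun x hx => ?_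
    by_cases h : x ∈ interior K
    · exact (hFan x h).differentiableAt
    · refine (hC1.1 x ⟨hx, h⟩).of_le_of_le_add_sq ?_
      filter_upwards [hUopen.mem_nhds hx] with y hy using ⟨hFle y hy, hFsq x h y hy⟩
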